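/- Let $D$ be an integral domain with quotient field $K$, let $\overline{F}(D)$ be the set of nonzero $D$-submodules of $K$, and let $f(D)$ be the set of finitely generated members of $\overline{F}(D)$. A semistar operation on $D$ is a map $\star:\overline{F}(D)\to\overline{F}(D)$, $E\mapsto E^\star$, such that for all $0\neq x\in K$ and $E,F\in\overline{F}(D)$: $(xE)^\star=xE^\star$; $E\subseteq F$ implies $E^\star\subseteq F^\star$; $E\subseteq E^\star$ and $(E^\star)^\star=E^\star$. Its associated finite-type operation is $E^{\star_f}=\bigcup\{F^\star\mid F\in f(D),\ F\subseteq E\}$; it is again a semistar operation, and $D^\star=D^{\star_f}$ is an overring of $D$. A quasi-$\star_f$-ideal of $D$ is a nonzero ideal $I$ with $I=I^{\star_f}\cap D$; a quasi-$\star_f$-prime is a prime quasi-$\star_f$-ideal; a quasi-$\star_f$-maximal ideal is a maximal element of the set of proper quasi-$\star_f$-ideals (such an ideal is prime). A quasi-$\star_f$-prime $P$ is $\star_f$-sharp if $\bigcap_M D_M\nsubseteq D_P$, where $M$ runs over the quasi-$\star_f$-maximal ideals with $M\nsupseteq P$ (the intersection being $K$ if there are none), and $D$ is $\star_f$-doublesharp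 if each of its quasi-$\star_f$-primes is $\star_f$-sharp. $D$ is a Prüfer $\star$-multiplication domain (P$\star$MD) if $(FF^{-1})^{\star_f}=D^{\star_f}$ for every $F\in f(D)$, where $F^{-1}=\{u\in K\mid uF\subseteq D\}$. **Theorem.** Let $\star$ be a semistar operation on $D$ such that $D$ is a $\star_f$-doublesharp P$\star$MD, and let $P$ be a quasi-$\star_f$-prime of $D$ that is not quasi-$\star_f$-maximal. Then $P^{\star_f}$ is a divisorial ideal of $D^\star$; that is, $P^{\star_f}$ is a nonzero ideal of the ring $D^\star$ and $(D^\star:(D^\star:P^{\star_f}))=P^{\star_f}$, where $(D^\star:E)=\{x\in K\mid xE\subseteq D^\star\}$. -/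

import Mathlib

open scoped Pointwise

/-- A semistar operation on the domain `D` with quotient field `K`: a map `E ↦ E^⋆` on the nonzero
`D`-submodules of `K` that commutes with multiplication by nonzero elements of `K` and is monotone,
extensive and idempotent. So that it can be applied to every submodule, it is extended
(uniquely) to the zero submodule by `0^⋆ = 0`; on nonzero submodules the values are automatically
nonzero, by extensivity. -/
structure SemistarOperation (D K : Type*) [CommRing D] [Field K] [Algebra D K] where
  /-- The map `E ↦ E^⋆`. -/
  op : Submodule D K → Submodule D K
  op_bot : op ⊥ = ⊥
  op_smul : ∀ x : K, x ≠ 0 → ∀ E : Submodule D K, E ≠ ⊥ → op (x • E) = x • op E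
  op_mono : ∀ E F : Submodule D K, E ≠ ⊥ → F ≠ ⊥ → E ≤ F → op E ≤ op F
  le_op : ∀ E : Submodule D K, E ≠ ⊥ → E ≤ op E
  op_op : ∀ E : Submodule D K, E ≠ ⊥ → op (op E) = op E

/-- For an ideal `P` of `D`, the set of fractions `a / s` in `K` with `a, s ∈ D` and `s ∉ P`.
For `P` prime this is the localization `D_P` inside `K`. -/
def fractionsAt {D : Type*} (K : Type*) [CommRing D] [Field K] [Algebra D K] (P : Ideal D) :
    Set K :=
  {x | ∃ a s : D, s ∉ P ∧ x = algebraMap D K a / algebraMap D K s}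

theorem fractionsAt_eq_localization {D : Type*} (K : Type*) [CommRing D] [IsDomain D] [Field K]
    [Algebra D K] [IsFractionRing D K] (P : Ideal D) [P.IsPrime] :
    fractionsAt K P =
      (Localization.subalgebra.ofField K P.primeCompl P.primeCompl_le_nonZeroDivisors :
        Set K) := by
  ext x
  change _ ↔ ∃ (a s : D) (_ : s ∈ P.primeCompl), x = algebraMap D K a * (algebraMap D K s)⁻¹
  simp only [fractionsAt, Set.mem_ofPred_eq, div_eq_mul_inv, exists_prop, Ideal.mem_primeCompl_iff]

/-- An ideal `I` of a domain `R` with quotient field `K` is divisorial if it is nonzero and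
`(R : (R : I)) = I`, where `(R : E) = {x ∈ K | x E ⊆ R}`. -/
def IsDivisorialIdeal {R : Type*} (K : Type*) [CommRing R] [Field K] [Algebra R K]
    (I : Ideal R) : Prop :=
  I ≠ ⊥ ∧
    (1 : Submodule R K) / ((1 : Submodule R K) / IsLocalization.coeSubmodule K I) =
      IsLocalization.coeSubmodule K I

namespace SemistarOperation

variable {D K : Type*} [CommRing D] [Field K] [Algebra D K]

theorem mono (s : SemistarOperation D K) {E F : Submodule D K} (h : E ≤ F) :
    s.op E ≤ s.op F := by
  by_cases hE : E = ⊥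
  · subst hE
    rw [s.op_bot]
    exact bot_le
  · have hF : F ≠ ⊥ := by
      rintro rfl
      exact hE (le_bot_iff.mp h)
    exact s.op_mono E F hE hF h

theorem le (s : SemistarOperation D K) (E : Submodule D K) : E ≤ s.op E := by
  by_cases hE : E = ⊥
  · subst hE
    exact bot_le
  · exact s.le_op E hE

theorem idem (s : SemistarOperation D K) (E : Submodule D K) : s.op (s.op E) = s.op E := by
  by_cases hE : E = ⊥
  · subst hE
    rw [s.op_bot, s.op_bot]
  · exact s.op_op E hE

theorem smul_op (s : SemistarOperation D K) {x : K} (hx : x ≠ 0) (E : Submodule D K) :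
    s.op (x • E) = x • s.op E := by
  by_cases hE : E = ⊥
  · subst hE
    rw [s.op_bot, Submodule.smul_bot', s.op_bot]
  · exact s.op_smul x hx E hE

/-- The submodule `⋃ {F^⋆ | F finitely generated, F ⊆ E}`. The zero submodule `F = 0` contributes
only the element `0`. -/
def finOp (s : SemistarOperation D K) (E : Submodule D K) : Submodule D K where
  carrier := {x | ∃ F : Submodule D K, F.FG ∧ F ≤ E ∧ x ∈ s.op F}
  zero_mem' := ⟨⊥, Submodule.fg_bot, bot_le, zero_mem _⟩
  add_mem' := by
    rintro x y ⟨F, hF, hFE, hx⟩ ⟨G, hG, hGE, hy⟩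
    exact ⟨F ⊔ G, hF.sup hG, sup_le hFE hGE,
      add_mem (s.mono le_sup_left hx) (s.mono le_sup_right hy)⟩
  smul_mem' := by
    rintro c x ⟨F, hF, hFE, hx⟩
    exact ⟨F, hF, hFE, Submodule.smul_mem _ c hx⟩

theorem mem_finOp (s : SemistarOperation D K) {E : Submodule D K} {x : K} :
    x ∈ s.finOp E ↔ ∃ F : Submodule D K, F.FG ∧ F ≤ E ∧ x ∈ s.op F := Iff.rfl

theorem finOp_mono (s : SemistarOperation D K) {E F : Submodule D K} (h : E ≤ F) :
    s.finOp E ≤ s.finOp F := by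
  rintro x ⟨G, hG, hGE, hx⟩
  exact ⟨G, hG, hGE.trans h, hx⟩

theorem le_finOp (s : SemistarOperation D K) (E : Submodule D K) : E ≤ s.finOp E := by
  intro x hx
  refine ⟨Submodule.span D {x}, Submodule.fg_span_singleton x, ?_, s.le _ ?_⟩
  · rw [Submodule.span_singleton_le_iff_mem]
    exact hx
  · exact Submodule.mem_span_singleton_self x

theorem exists_fg_of_le_finOp (s : SemistarOperation D K) {E F : Submodule D K} (hF : F.FG)
    (h : F ≤ s.finOp E) : ∃ G : Submodule D K, G.FG ∧ G ≤ E ∧ F ≤ s.op G := by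
  induction F, hF using Submodule.fg_induction with
  | singleton x =>
    obtain ⟨G, hG, hGE, hx⟩ := h (Submodule.mem_span_singleton_self x)
    exact ⟨G, hG, hGE, by rwa [Submodule.span_singleton_le_iff_mem]⟩
  | sup A B hA hB ihA ihB =>
    obtain ⟨G, hG, hGE, hAG⟩ := ihA (le_sup_left.trans h)
    obtain ⟨H, hH, hHE, hBH⟩ := ihB (le_sup_right.trans h)
    exact ⟨G ⊔ H, hG.sup hH, sup_le hGE hHE,
      sup_le (hAG.trans (s.mono le_sup_left)) (hBH.trans (s.mono le_sup_right))⟩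

theorem smul_finOp_le (s : SemistarOperation D K) {x : K} (hx : x ≠ 0) (E : Submodule D K) :
    x • s.finOp E ≤ s.finOp (x • E) := by
  intro y hy
  obtain ⟨z, ⟨F, hF, hFE, hz⟩, rfl⟩ := (Submodule.mem_smul_pointwise_iff_exists _ _ _).mp hy
  refine ⟨x • F, hF.map _, Submodule.map_mono hFE, ?_⟩
  rw [s.smul_op hx]
  exact Submodule.smul_mem_pointwise_smul _ _ _ hz

/-- The finite-type semistar operation `⋆_f` associated with `⋆`:
`E^{⋆_f} = ⋃ {F^⋆ | F finitely generated, F ⊆ E}`. -/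
def finType (s : SemistarOperation D K) : SemistarOperation D K where
  op := s.finOp
  op_bot := by
    refine le_bot_iff.mp ?_
    rintro x ⟨F, -, hF, hx⟩
    rw [le_bot_iff.mp hF, s.op_bot] at hx
    exact hx
  op_smul := by
    intro x hx E _
    refine le_antisymm ?_ (s.smul_finOp_le hx E)
    have h := s.smul_finOp_le (inv_ne_zero hx) (x • E)
    rw [smul_smul, inv_mul_cancel₀ hx, one_smul] at h
    intro y hy
    have h' := h (Submodule.smul_mem_pointwise_smul y x⁻¹ _ hy)
    have h2 := Submodule.smul_mem_pointwise_smul _ x _ h'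
    rwa [smul_smul, mul_inv_cancel₀ hx, one_smul] at h2
  op_mono := fun _ _ _ _ h => s.finOp_mono h
  le_op := fun E _ => s.le_finOp E
  op_op := by
    intro E _
    refine le_antisymm ?_ (s.le_finOp _)
    rintro x ⟨F, hF, hFE, hx⟩
    obtain ⟨G, hG, hGE, hFG⟩ := s.exists_fg_of_le_finOp hF hFE
    refine ⟨G, hG, hGE, ?_⟩
    have := s.mono hFG hx
    rwa [s.idem] at this

/-- `I^⋆` for an ideal `I` of `D`, regarded as a submodule of `K`. -/
def opIdeal (s : SemistarOperation D K) (I : Ideal D) : Submodule D K :=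
  s.op (IsLocalization.coeSubmodule K I)

/-- The overring `D^⋆` of `D`. -/
def ring (s : SemistarOperation D K) : Subalgebra D K :=
  (s.op 1).toSubalgebra (s.le 1 (Submodule.mem_one.mpr ⟨1, map_one _⟩)) (by
    intro x y hx hy
    by_cases h0 : x = 0
    · rw [h0, zero_mul]
      exact zero_mem _
    · have h1 : x • (1 : Submodule D K) ≤ s.op 1 := by
        intro z hz
        obtain ⟨w, hw, rfl⟩ := (Submodule.mem_smul_pointwise_iff_exists _ _ _).mp hz
        obtain ⟨d, rfl⟩ := Submodule.mem_one.mp hw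
        rw [smul_eq_mul, mul_comm, ← Algebra.smul_def]
        exact Submodule.smul_mem _ d hx
      have h2 := s.mono h1
      rw [s.idem, s.smul_op h0] at h2
      exact h2 (Submodule.smul_mem_pointwise_smul y x _ hy))

/-- A quasi-`⋆`-ideal: a nonzero ideal `I` with `I = I^⋆ ∩ D`. -/
def IsQuasiIdeal (s : SemistarOperation D K) (I : Ideal D) : Prop :=
  I ≠ ⊥ ∧ I = (s.opIdeal I).comap (Algebra.linearMap D K)

/-- `QSpec^⋆(D)`: the prime quasi-`⋆`-ideals. -/
def qSpec (s : SemistarOperation D K) : Set (Ideal D) :=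
  {P | P.IsPrime ∧ s.IsQuasiIdeal P}

/-- `QMax^⋆(D)`: the maximal elements of the set of proper quasi-`⋆`-ideals. -/
def qMax (s : SemistarOperation D K) : Set (Ideal D) :=
  {M | Maximal (fun I : Ideal D => I ≠ ⊤ ∧ s.IsQuasiIdeal I) M}

/-- `Θ^⋆(P)`: the intersection of the localizations `D_M`, where `M` runs over the
quasi-`⋆`-maximal ideals that do not contain `P` (all of `K` if there are none). -/
def theta (s : SemistarOperation D K) (P : Ideal D) : Set K :=
  {x | ∀ M ∈ s.qMax, ¬ P ≤ M → x ∈ fractionsAt K M}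

/-- `P` is `⋆`-sharp: `Θ^⋆(P) ⊈ D_P`. -/
def IsSharpAt (s : SemistarOperation D K) (P : Ideal D) : Prop :=
  ¬ s.theta P ⊆ fractionsAt K P

/-- `D` is `⋆`-doublesharp: every quasi-`⋆`-prime ideal is `⋆`-sharp. -/
def IsDoublesharp (s : SemistarOperation D K) : Prop :=
  ∀ P ∈ s.qSpec, s.IsSharpAt P

/-- `D` is a Prüfer `⋆`-multiplication domain: `(F F⁻¹)^{⋆_f} = D^{⋆_f}` for every nonzero finitely
generated `D`-submodule `F` of `K`, where `F⁻¹ = (D : F) = {u ∈ K | u F ⊆ D}`. -/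
def IsPruferMultiplicationDomain (s : SemistarOperation D K) : Prop :=
  ∀ F : Submodule D K, F ≠ ⊥ → F.FG →
    s.finType.op (F * ((1 : Submodule D K) / F)) = s.finType.op 1

/-- A quasi-`⋆`-maximal ideal is prime, so that the sets `fractionsAt K M` in the
definition of `theta` are localizations at primes. -/
theorem isPrime_of_mem_qMax (s : SemistarOperation D K) [FaithfulSMul D K] {M : Ideal D}
    (hM : M ∈ s.qMax) : M.IsPrime := by
  have hinj : Function.Injective (algebraMap D K) := FaithfulSMul.algebraMap_injective D K
  obtain ⟨⟨htop, hbot, hq⟩, hmax⟩ := hM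
  refine ⟨htop, ?_⟩
  intro a b hab
  by_contra! hcon
  obtain ⟨ha, hb⟩ := hcon
  have ha0 : algebraMap D K a ≠ 0 := by
    intro h
    rw [← map_zero (algebraMap D K)] at h
    exact ha (hinj h ▸ M.zero_mem)
  let J : Ideal D := Submodule.comap (LinearMap.mulLeft D a) M
  have memJ : ∀ x, x ∈ J ↔ a * x ∈ M := fun x => Iff.rfl
  have hMJ : M ≤ J := fun x hx => M.mul_mem_left a hx
  have hJ : J ≠ ⊤ ∧ s.IsQuasiIdeal J := by
    refine ⟨?_, ?_, le_antisymm ?_ ?_⟩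
    · intro h
      have : (1 : D) ∈ J := h ▸ Submodule.mem_top
      rw [memJ, mul_one] at this
      exact ha this
    · intro h
      exact hbot (le_bot_iff.mp (h ▸ hMJ))
    · intro x hx
      exact s.le _ ⟨x, hx, rfl⟩
    · intro x hx
      rw [memJ, hq]
      have h1 : algebraMap D K a • IsLocalization.coeSubmodule K J ≤
          IsLocalization.coeSubmodule K M := by
        intro z hz
        obtain ⟨w, ⟨y, hy, rfl⟩, rfl⟩ :=
          (Submodule.mem_smul_pointwise_iff_exists _ _ _).mp hz
        exact ⟨a * y, hy, by simp⟩
      have h2 := s.mono h1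
      rw [s.smul_op ha0] at h2
      have h3 := h2 (Submodule.smul_mem_pointwise_smul _ (algebraMap D K a) _ hx)
      simpa [opIdeal] using h3
  exact hb (hmax hJ hMJ ((memJ b).mpr hab))

end SemistarOperation

namespace SemistarOperation

variable {D K : Type*} [CommRing D] [Field K] [Algebra D K]

/-! In a P⋆MD each `D_Q`, for `Q` a quasi-`⋆_f`-prime, is a valuation ring containing `D^⋆`
(`mem_fractionsAt_or`, `op_one_subset`). A prime `P ⊆ M` of a valuation ring `D_M` satisfies `P D_P
= P D_M`, and `P D_M = D_M` when `P ⊈ M`. Checking locally at the quasi-`⋆_f`-maximal ideals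
therefore gives `P D_P ∩ Θ(P) = P^{⋆_f}`, so every element of `D_P ∩ Θ(P)` multiplies `P^{⋆_f}` into
itself.

Let `y ∈ D^⋆` lie outside `P^{⋆_f}`; then `y` is a unit of `D_P`. Choose a quasi-`⋆_f`-maximal `M ⊋
P`, some `m ∈ M \ P`, and by sharpness `t ∈ Θ(P) \ D_P`. Then `(y m t)⁻¹ ∈ P D_P = P D_M`, say `q /
e` with `q ∈ P` and `e ∉ M`. The element `z = t q = e / (y m)` lies in `D_P ∩ Θ(P)`, but `z y = e /
m ∉ D_M ⊇ D^⋆`. So `y` is not in the double dual of `P^{⋆_f}`. -/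

theorem finType_op_one (s : SemistarOperation D K) : s.finType.op 1 = s.op 1 := by
  refine le_antisymm ?_ fun x hx => ⟨1, ?_, le_rfl, hx⟩
  · rintro x ⟨F, -, hF, hx⟩
    exact s.mono hF hx
  · rw [Submodule.one_eq_span]
    exact Submodule.fg_span_singleton 1

/-- This compactness makes the union of a chain of quasi-`⋆_f`-ideals a quasi-`⋆_f`-ideal, as Zorn's
lemma requires. -/
theorem exists_fg_of_mem_finType_op (s : SemistarOperation D K) {E : Submodule D K} {x : K}
    (hx : x ∈ s.finType.op E) :
    ∃ F : Submodule D K, F.FG ∧ F ≤ E ∧ x ∈ s.finType.op F := by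
  obtain ⟨F, hF, hFE, hx⟩ := hx
  exact ⟨F, hF, hFE, F, hF, le_rfl, hx⟩

theorem algebraMap_mem_opIdeal (r : SemistarOperation D K) {I : Ideal D} {d : D} (hd : d ∈ I) :
    algebraMap D K d ∈ r.opIdeal I :=
  r.le _ ⟨d, hd, rfl⟩

theorem opIdeal_le_op_one (r : SemistarOperation D K) (I : Ideal D) :
    r.opIdeal I ≤ r.op 1 := by
  refine r.mono ?_
  rintro _ ⟨d, -, rfl⟩
  exact Submodule.mem_one.mpr ⟨d, rfl⟩

theorem IsQuasiIdeal.mem_iff {r : SemistarOperation D K} {I : Ideal D} (hI : r.IsQuasiIdeal I)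
    {d : D} : d ∈ I ↔ algebraMap D K d ∈ r.opIdeal I := by
  conv_lhs => rw [hI.2]
  rfl

/-- An element that multiplies `E` into `F^⋆` multiplies `E^⋆` into `F^⋆`. -/
theorem mul_mem_op (r : SemistarOperation D K) {E F : Submodule D K} {x y : K}
    (hxE : ∀ e ∈ E, x * e ∈ r.op F) (hy : y ∈ r.op E) : x * y ∈ r.op F := by
  by_cases hx : x = 0
  · rw [hx, zero_mul]
    exact zero_mem _
  · have h : x • E ≤ r.op F := by
      intro z hz
      obtain ⟨e, he, rfl⟩ := (Submodule.mem_smul_pointwise_iff_exists _ _ _).mp hz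
      exact hxE e he
    have h' := r.mono h
    rw [r.idem, r.smul_op hx] at h'
    exact h' (Submodule.smul_mem_pointwise_smul y x _ hy)

theorem mul_mem_op_of_mem_op_one (r : SemistarOperation D K) {E : Submodule D K} {x y : K}
    (hx : x ∈ r.op 1) (hy : y ∈ r.op E) : x * y ∈ r.op E := by
  rw [mul_comm]
  refine r.mul_mem_op (fun e he => ?_) hx
  obtain ⟨d, rfl⟩ := Submodule.mem_one.mp he
  rw [mul_comm, ← Algebra.smul_def]
  exact Submodule.smul_mem _ d hy

/-- The quasi-`⋆`-ideal generated by a nonzero ideal. -/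
theorem isQuasiIdeal_comap_opIdeal (r : SemistarOperation D K) {I : Ideal D} (hI : I ≠ ⊥) :
    r.IsQuasiIdeal ((r.opIdeal I).comap (Algebra.linearMap D K)) := by
  have hle : I ≤ (r.opIdeal I).comap (Algebra.linearMap D K) :=
    fun d hd => r.algebraMap_mem_opIdeal hd
  refine ⟨fun h => hI (le_bot_iff.mp (h ▸ hle)), le_antisymm ?_ ?_⟩
  · exact fun d hd => r.algebraMap_mem_opIdeal hd
  · refine Submodule.comap_mono ?_
    have h := r.mono (Submodule.map_comap_le (Algebra.linearMap D K) (r.opIdeal I))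
    rwa [opIdeal, r.idem] at h

theorem mul_mem_fractionsAt {P : Ideal D} (hP : P.IsPrime) {x y : K}
    (hx : x ∈ fractionsAt K P) (hy : y ∈ fractionsAt K P) : x * y ∈ fractionsAt K P := by
  obtain ⟨a, c, hc, rfl⟩ := hx
  obtain ⟨b, d, hd, rfl⟩ := hy
  refine ⟨a * b, c * d, fun h => (hP.mem_or_mem h).elim hc hd, ?_⟩
  rw [map_mul, map_mul, div_mul_div_comm]

theorem algebraMap_mem_fractionsAt {P : Ideal D} (hP : P.IsPrime) (d : D) :
    algebraMap D K d ∈ fractionsAt K P :=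
  ⟨d, 1, fun h => hP.ne_top ((Ideal.eq_top_iff_one P).mpr h), by simp⟩

/-! ### Quasi-`⋆_f`-maximal ideals and local membership. -/

/-- For a semistar operation of finite type, every proper quasi-ideal is contained in a
quasi-maximal ideal. -/
theorem exists_le_mem_qMax (s : SemistarOperation D K) {I : Ideal D} (htop : I ≠ ⊤)
    (hI : s.finType.IsQuasiIdeal I) : ∃ M ∈ s.finType.qMax, I ≤ M := by
  suffices h : ∀ c ⊆ {J : Ideal D | J ≠ ⊤ ∧ s.finType.IsQuasiIdeal J}, IsChain (· ≤ ·) c →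
      ∀ J ∈ c, ∃ N ∈ {J : Ideal D | J ≠ ⊤ ∧ s.finType.IsQuasiIdeal J}, ∀ L ∈ c, L ≤ N by
    obtain ⟨M, hIM, hM⟩ := zorn_le_nonempty₀ _ h I ⟨htop, hI⟩
    exact ⟨M, hM, hIM⟩
  intro c hc hchain J hJ
  have hne : c.Nonempty := ⟨J, hJ⟩
  have hdir : DirectedOn (· ≤ ·) c := hchain.directedOn
  have hmem : ∀ {x : D}, x ∈ sSup c ↔ ∃ L ∈ c, x ∈ L :=
    Submodule.mem_sSup_of_directed hne hdir
  refine ⟨sSup c, ⟨?_, ?_, le_antisymm ?_ ?_⟩, fun L hL => le_sSup hL⟩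
  · intro h
    obtain ⟨L, hL, h1⟩ := hmem.mp (h ▸ Submodule.mem_top : (1 : D) ∈ sSup c)
    exact (hc hL).1 ((Ideal.eq_top_iff_one L).mpr h1)
  · exact fun h => (hc hJ).2.1 (le_bot_iff.mp (h ▸ le_sSup hJ))
  · exact fun d hd => s.finType.algebraMap_mem_opIdeal hd
  · intro d hd
    obtain ⟨F, hF, hFc, hdF⟩ := s.exists_fg_of_mem_finType_op hd
    -- Each generator lies in some member of the chain, and directedness gives one member for all of
    -- `F`.
    obtain ⟨L, hL, hFL⟩ : ∃ L ∈ c, F ≤ IsLocalization.coeSubmodule K L := by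
      clear hdF
      induction F, hF using Submodule.fg_induction with
      | singleton x =>
        obtain ⟨e, he, rfl⟩ := hFc (Submodule.mem_span_singleton_self x)
        obtain ⟨L, hL, heL⟩ := hmem.mp he
        refine ⟨L, hL, ?_⟩
        rw [Submodule.span_singleton_le_iff_mem]
        exact ⟨e, heL, rfl⟩
      | sup A B hA hB ihA ihB =>
        obtain ⟨L, hL, hAL⟩ := ihA (le_sup_left.trans hFc)
        obtain ⟨N, hN, hBN⟩ := ihB (le_sup_right.trans hFc)
        obtain ⟨R, hR, hLR, hNR⟩ := hdir L hL N hN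
        exact ⟨R, hR, sup_le (hAL.trans (Submodule.map_mono hLR))
          (hBN.trans (Submodule.map_mono hNR))⟩
    exact hmem.mpr ⟨L, hL, (hc hL).2.mem_iff.mpr (s.finType.mono hFL hdF)⟩

/-- An element of `K` that lies in `E^{⋆_f}` locally at each quasi-`⋆_f`-maximal ideal
lies in `E^{⋆_f}`. -/
theorem mem_op_of_locally_mem (s : SemistarOperation D K) (hne : s.finType.qMax.Nonempty)
    {E : Submodule D K} {x : K}
    (h : ∀ M ∈ s.finType.qMax, ∃ d ∉ M, algebraMap D K d * x ∈ s.finType.op E) :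
    x ∈ s.finType.op E := by
  -- `J` is the conductor of `x` into `E^{⋆_f}`. No quasi-`⋆_f`-maximal ideal contains it, so `1 ∈
  -- J^{⋆_f}`, and `x J ⊆ E^{⋆_f}` extends to `x J^{⋆_f} ⊆ E^{⋆_f}`.
  let J : Ideal D := (s.finType.op E).comap (LinearMap.toSpanSingleton D K x)
  have hmem : ∀ d, d ∈ J ↔ algebraMap D K d * x ∈ s.finType.op E := by
    intro d
    rw [← Algebra.smul_def]
    rfl
  have hJM : ∀ M ∈ s.finType.qMax, ¬ J ≤ M := by
    intro M hM hle
    obtain ⟨d, hd, hdx⟩ := h M hM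
    exact hd (hle ((hmem d).mpr hdx))
  -- The existence of a quasi-`⋆_f`-maximal ideal serves only to exclude the zero ideal.
  have hJ : J ≠ ⊥ := by
    obtain ⟨M, hM⟩ := hne
    exact fun h0 => hJM M hM (h0 ▸ bot_le)
  have hone : (1 : K) ∈ s.finType.opIdeal J := by
    by_contra hone
    obtain ⟨M, hM, hle⟩ := s.exists_le_mem_qMax
      (fun htop => hone (by
        have := (Ideal.eq_top_iff_one _).mp htop
        simpa using this))
      (s.finType.isQuasiIdeal_comap_opIdeal hJ)
    exact hJM M hM (le_trans (fun d hd => s.finType.algebraMap_mem_opIdeal hd) hle)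
  have := s.finType.mul_mem_op (x := x) (F := E) (fun e he => by
    obtain ⟨d, hd, rfl⟩ := he
    rw [mul_comm]
    exact (hmem d).mp hd) hone
  rwa [mul_one] at this

/-! ### Localizations at quasi-`⋆_f`-primes as valuation rings. -/

variable [FaithfulSMul D K]

theorem qMax_subset_qSpec (r : SemistarOperation D K) : r.qMax ⊆ r.qSpec :=
  fun _ hM => ⟨r.isPrime_of_mem_qMax hM, hM.1.2⟩

/-- The dichotomy for the valuation ring `D_Q`: an element of `K` lies in `D_Q`
or its inverse lies in the maximal ideal of `D_Q`. -/
theorem IsPruferMultiplicationDomain.mem_fractionsAt_or {s : SemistarOperation D K}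
    (hP : s.IsPruferMultiplicationDomain) {Q : Ideal D} (hQ : Q ∈ s.finType.qSpec) (x : K) :
    x ∈ fractionsAt K Q ∨
      ∃ a ∈ Q, ∃ c ∉ Q, algebraMap D K a * x = algebraMap D K c := by
  have h1 : (1 : K) ∈ Submodule.span D {1, x} := Submodule.subset_span (by simp)
  have hx : x ∈ Submodule.span D {1, x} := Submodule.subset_span (by simp)
  have hbot : Submodule.span D {1, x} ≠ ⊥ :=
    fun h => one_ne_zero ((Submodule.mem_bot D).mp (h ▸ h1))
  have hprod := hP _ hbot (Submodule.fg_span (by simp))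
  by_contra! hcon
  obtain ⟨hfrac, hinv⟩ := hcon
  -- For `F = D + Dx` and `u ∈ F⁻¹`, both `u = d` and `u x = e` lie in `D`. If both alternatives
  -- fail, then `d, e ∈ Q`, so `F F⁻¹ ⊆ Q` and `1 ∈ Q^{⋆_f}`.
  have hle : Submodule.span D {1, x} * ((1 : Submodule D K) / Submodule.span D {1, x}) ≤
      IsLocalization.coeSubmodule K Q := by
    rw [Submodule.mul_le]
    intro f hf u hu
    obtain ⟨d, hd⟩ := Submodule.mem_one.mp (Submodule.mem_div_iff_forall_mul_mem.mp hu 1 h1)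
    obtain ⟨e, he⟩ := Submodule.mem_one.mp (Submodule.mem_div_iff_forall_mul_mem.mp hu x hx)
    rw [mul_one] at hd
    have hdQ : d ∈ Q := by
      by_contra hdQ
      refine hfrac ⟨e, d, hdQ, ?_⟩
      have : algebraMap D K d ≠ 0 := by
        rw [Ne, FaithfulSMul.algebraMap_eq_zero_iff]
        rintro rfl
        exact hdQ Q.zero_mem
      rw [eq_div_iff this, he, hd, mul_comm]
    have heQ : e ∈ Q := by
      by_contra heQ
      exact hinv d hdQ e heQ (by rw [he, hd])
    obtain ⟨α, β, rfl⟩ := Submodule.mem_span_pair.mp hf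
    refine ⟨α * d + β * e, Q.add_mem (Q.mul_mem_left _ hdQ) (Q.mul_mem_left _ heQ), ?_⟩
    simp only [Algebra.linearMap_apply, map_add, map_mul, hd, he, Algebra.smul_def]
    ring
  have hone : (1 : K) ∈ s.finType.opIdeal Q := by
    refine s.finType.mono hle ?_
    rw [hprod]
    exact s.finType.le 1 (Submodule.mem_one.mpr ⟨1, map_one _⟩)
  refine hQ.1.ne_top ((Ideal.eq_top_iff_one Q).mpr (hQ.2.mem_iff.mpr ?_))
  rwa [map_one]

/-- `D^{⋆_f}` is contained in `D_Q`. -/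
theorem IsPruferMultiplicationDomain.op_one_subset {s : SemistarOperation D K}
    (hP : s.IsPruferMultiplicationDomain) {Q : Ideal D} (hQ : Q ∈ s.finType.qSpec) {x : K}
    (hx : x ∈ s.finType.op 1) : x ∈ fractionsAt K Q := by
  refine (hP.mem_fractionsAt_or hQ x).resolve_right ?_
  -- Otherwise `c = a x` would lie in `Q^{⋆_f} ∩ D = Q`.
  rintro ⟨a, ha, c, hc, hac⟩
  refine hc (hQ.2.mem_iff.mpr ?_)
  rw [← hac, mul_comm]
  exact s.finType.mul_mem_op_of_mem_op_one hx (s.finType.algebraMap_mem_opIdeal ha)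

/-- `P^{⋆_f}` is contained in `P D_P`. -/
theorem IsPruferMultiplicationDomain.exists_mul_eq_of_mem_opIdeal {s : SemistarOperation D K}
    (hP : s.IsPruferMultiplicationDomain) {P : Ideal D} (hPs : P ∈ s.finType.qSpec) {x : K}
    (hx : x ∈ s.finType.opIdeal P) :
    ∃ a ∈ P, ∃ c ∉ P, algebraMap D K c * x = algebraMap D K a := by
  obtain ⟨a, c, hc, rfl⟩ := hP.op_one_subset hPs (s.finType.opIdeal_le_op_one P hx)
  have hc0 : algebraMap D K c ≠ 0 := by
    rw [Ne, FaithfulSMul.algebraMap_eq_zero_iff]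
    rintro rfl
    exact hc P.zero_mem
  have hac : algebraMap D K c * (algebraMap D K a / algebraMap D K c) = algebraMap D K a :=
    mul_div_cancel₀ _ hc0
  refine ⟨a, hPs.2.mem_iff.mpr ?_, c, hc, hac⟩
  rw [← hac, ← Algebra.smul_def]
  exact Submodule.smul_mem _ c hx

/-- If `P ⊆ M`, then `P D_P` is contained in `P D_M`. -/
theorem IsPruferMultiplicationDomain.exists_notMem_mul_eq {s : SemistarOperation D K}
    (hP : s.IsPruferMultiplicationDomain) {P M : Ideal D} (hPp : P.IsPrime)
    (hM : M ∈ s.finType.qSpec) (hPM : P ≤ M) {x : K} {a c : D} (ha : a ∈ P) (hc : c ∉ P)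
    (hx : algebraMap D K c * x = algebraMap D K a) :
    ∃ p ∈ P, ∃ d ∉ M, algebraMap D K d * x = algebraMap D K p := by
  have hinj : Function.Injective (algebraMap D K) := FaithfulSMul.algebraMap_injective D K
  -- If `x = p / d` in `D_M`, primality moves `p` into `P`. If instead `x⁻¹ = b / d` with `b ∈ M`,
  -- then `c d = b a ∈ P` forces `d ∈ P ⊆ M`, a contradiction.
  rcases hP.mem_fractionsAt_or hM x with ⟨p, d, hd, rfl⟩ | ⟨b, hb, d, hd, hbd⟩
  · have hd0 : algebraMap D K d ≠ 0 := by
      rw [Ne, FaithfulSMul.algebraMap_eq_zero_iff]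
      rintro rfl
      exact hd M.zero_mem
    refine ⟨p, ?_, d, hd, mul_div_cancel₀ _ hd0⟩
    have hcp : c * p = a * d := by
      apply hinj
      rw [map_mul, map_mul, ← hx]
      field_simp
    exact (hPp.mem_or_mem (hcp ▸ P.mul_mem_right d ha : c * p ∈ P)).resolve_left hc
  · have hcd : c * d = b * a := by
      apply hinj
      rw [map_mul, map_mul, ← hx, ← hbd]
      ring
    rcases hPp.mem_or_mem (hcd ▸ P.mul_mem_left b ha : c * d ∈ P) with h | h
    · exact absurd h hc
    · exact absurd (hPM h) hd

/-! ### Elements and multipliers of `P^{⋆_f}`. -/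

/-- `P^{⋆_f}` contains `P D_P ∩ D^{⋆_f}`; more generally the elements of `P D_P` that lie
in `D_M` for each quasi-`⋆_f`-maximal ideal `M` not containing `P`. -/
theorem IsPruferMultiplicationDomain.mem_opIdeal_of_mem_theta {s : SemistarOperation D K}
    (hP : s.IsPruferMultiplicationDomain) {P : Ideal D} (hPs : P ∈ s.finType.qSpec) {x : K}
    {a c : D} (ha : a ∈ P) (hc : c ∉ P) (hx : algebraMap D K c * x = algebraMap D K a)
    (hθ : x ∈ s.finType.theta P) : x ∈ s.finType.opIdeal P := by
  obtain ⟨M₀, hM₀, -⟩ := s.exists_le_mem_qMax hPs.1.ne_top hPs.2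
  refine s.mem_op_of_locally_mem ⟨M₀, hM₀⟩ fun M hM => ?_
  by_cases hPM : P ≤ M
  · obtain ⟨p, hp, d, hd, hdx⟩ :=
      hP.exists_notMem_mul_eq hPs.1 (s.finType.qMax_subset_qSpec hM) hPM ha hc hx
    exact ⟨d, hd, hdx ▸ s.finType.algebraMap_mem_opIdeal hp⟩
  -- Here `P D_M = D_M`: a factor `p ∈ P \ M` pushes the numerator of `x` into `P`.
  · obtain ⟨p, hp, hpM⟩ := SetLike.not_le_iff_exists.mp hPM
    obtain ⟨b, d, hd, rfl⟩ := hθ M hM hPM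
    have hd0 : algebraMap D K d ≠ 0 := by
      rw [Ne, FaithfulSMul.algebraMap_eq_zero_iff]
      rintro rfl
      exact hd M.zero_mem
    refine ⟨p * d, fun h => ((s.finType.isPrime_of_mem_qMax hM).mem_or_mem h).elim hpM hd, ?_⟩
    rw [map_mul, mul_assoc, mul_div_cancel₀ _ hd0, ← map_mul]
    exact s.finType.algebraMap_mem_opIdeal (P.mul_mem_right b hp)

theorem mul_mem_theta (r : SemistarOperation D K) {P : Ideal D} {x y : K}
    (hx : x ∈ r.theta P) (hy : y ∈ r.theta P) : x * y ∈ r.theta P :=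
  fun M hM hPM => mul_mem_fractionsAt (r.isPrime_of_mem_qMax hM) (hx M hM hPM) (hy M hM hPM)

theorem algebraMap_mem_theta (r : SemistarOperation D K) {P : Ideal D} (d : D) :
    algebraMap D K d ∈ r.theta P :=
  fun _ hM _ => algebraMap_mem_fractionsAt (r.isPrime_of_mem_qMax hM) d

/-- An element of `D_P` that lies in `Θ(P)` multiplies `P^{⋆_f}` into itself. -/
theorem IsPruferMultiplicationDomain.mul_mem_opIdeal {s : SemistarOperation D K}
    (hP : s.IsPruferMultiplicationDomain) {P : Ideal D} (hPs : P ∈ s.finType.qSpec) {z w : K}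
    (hz : z ∈ fractionsAt K P) (hzθ : z ∈ s.finType.theta P) (hw : w ∈ s.finType.opIdeal P) :
    z * w ∈ s.finType.opIdeal P := by
  obtain ⟨a, ha, c, hc, hcw⟩ := hP.exists_mul_eq_of_mem_opIdeal hPs hw
  have hwθ : w ∈ s.finType.theta P := fun M hM _ =>
    hP.op_one_subset (s.finType.qMax_subset_qSpec hM) (s.finType.opIdeal_le_op_one P hw)
  obtain ⟨b, d, hd, rfl⟩ := hz
  have hd0 : algebraMap D K d ≠ 0 := by
    rw [Ne, FaithfulSMul.algebraMap_eq_zero_iff]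
    rintro rfl
    exact hd P.zero_mem
  refine hP.mem_opIdeal_of_mem_theta hPs (P.mul_mem_left b ha)
    (fun h => (hPs.1.mem_or_mem h).elim hd hc) ?_ (s.finType.mul_mem_theta hzθ hwθ)
  rw [map_mul, map_mul, ← hcw]
  field_simp

/-- If `P` is sharp and not quasi-maximal, then each element `y` of `D^{⋆_f}` outside `P^{⋆_f}`
is moved out of `D^{⋆_f}` by a multiplier of `P^{⋆_f}` into itself. -/
theorem IsPruferMultiplicationDomain.exists_mul_notMem {s : SemistarOperation D K}
    (hP : s.IsPruferMultiplicationDomain) {P : Ideal D} (hPs : P ∈ s.finType.qSpec)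
    (hsharp : s.finType.IsSharpAt P) (hPmax : P ∉ s.finType.qMax) {y : K}
    (hy : y ∈ s.finType.op 1) (hyP : y ∉ s.finType.opIdeal P) :
    ∃ z : K, (∀ w ∈ s.finType.opIdeal P, z * w ∈ s.finType.opIdeal P) ∧
      z * y ∉ s.finType.op 1 := by
  have hinj : Function.Injective (algebraMap D K) := FaithfulSMul.algebraMap_injective D K
  have hne : ∀ {I : Ideal D} {d : D}, d ∉ I → algebraMap D K d ≠ 0 := by
    intro I d hd h
    rw [FaithfulSMul.algebraMap_eq_zero_iff] at h
    exact hd (h ▸ I.zero_mem)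
  obtain ⟨M, hM, hPM⟩ := s.exists_le_mem_qMax hPs.1.ne_top hPs.2
  obtain ⟨m, hmM, hmP⟩ : ∃ m ∈ M, m ∉ P := by
    by_contra! h
    exact hPmax (le_antisymm hPM h ▸ hM)
  have hMs := s.finType.qMax_subset_qSpec hM
  obtain ⟨t, htθ, htP⟩ := Set.not_subset.mp hsharp
  obtain ⟨a, ha, c, hc, hac⟩ := (hP.mem_fractionsAt_or hPs t).resolve_left htP
  have hyθ : y ∈ s.finType.theta P := fun N hN _ =>
    hP.op_one_subset (s.finType.qMax_subset_qSpec hN) hy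
  obtain ⟨b, d, hd, rfl⟩ := hP.op_one_subset hPs hy
  -- Thus `y = b / d` is a unit of `D_P`.
  have hb : b ∉ P := fun hb =>
    hyP (hP.mem_opIdeal_of_mem_theta hPs hb hd (mul_div_cancel₀ _ (hne hd)) hyθ)
  have hb0 := hne hb
  have hc0 := hne hc
  have hd0 := hne hd
  have hm0 := hne hmP
  have ht0 : t ≠ 0 := by
    rintro rfl
    rw [mul_zero] at hac
    exact hc0 hac.symm
  -- Since `t⁻¹ = a / c`, the inverse of `y m t` is `d a / (b m c)`, an element of `P D_P`; it is
  -- rewritten as `q / e` over `D_M`.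
  obtain ⟨q, hq, e, he, heq⟩ := hP.exists_notMem_mul_eq hPs.1 hMs hPM
    (x := (algebraMap D K b / algebraMap D K d * algebraMap D K m * t)⁻¹)
    (P.mul_mem_left d ha)
    (fun h => (hPs.1.mem_or_mem h).elim
      (fun h => (hPs.1.mem_or_mem h).elim hb hmP) hc : b * m * c ∉ P)
    (by
      simp only [map_mul, ← hac]
      field_simp)
  have hz : t * algebraMap D K q =
      algebraMap D K (e * d) / algebraMap D K (b * m) := by
    simp only [← heq, map_mul]
    field_simp
  refine ⟨t * algebraMap D K q, fun w hw => hP.mul_mem_opIdeal hPs ?_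
    (s.finType.mul_mem_theta htθ (s.finType.algebraMap_mem_theta q)) hw, fun hmem => ?_⟩
  · exact ⟨e * d, b * m, fun h => (hPs.1.mem_or_mem h).elim hb hmP, hz⟩
  -- Writing `z y = e / m` as `g / h` with `h ∉ M` would put `e h = g m` in the prime `M`.
  · obtain ⟨g, h, hh, hgh⟩ := hP.op_one_subset hMs hmem
    have hh0 := hne hh
    rw [hz] at hgh
    have heh : e * h = g * m := by
      apply hinj
      simp only [map_mul] at hgh ⊢
      field_simp at hgh
      linear_combination hgh
    exact (hMs.1.mem_or_mem (heh ▸ M.mul_mem_left g hmM : e * h ∈ M)).elim he hh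

end SemistarOperation

/-! ### Divisoriality over the ring `D^⋆`. -/

theorem mainTheorem6 {D K : Type*} [CommRing D] [IsDomain D] [Field K] [Algebra D K]
    [IsFractionRing D K] (s : SemistarOperation D K)
    (hP : s.IsPruferMultiplicationDomain) (hsharp : s.finType.IsDoublesharp)
    (P : Ideal D) (hPspec : P ∈ s.finType.qSpec) (hPmax : P ∉ s.finType.qMax) :
    ∃ I : Ideal s.ring,
      (Subtype.val '' (I : Set s.ring) : Set K) = (s.finType.opIdeal P : Set K) ∧
        IsDivisorialIdeal K I := by
  let r := s.finType
  have hring : ∀ {x : K}, x ∈ s.ring ↔ x ∈ r.op 1 := by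
    intro x
    rw [s.finType_op_one]
    rfl
  let I : Ideal s.ring :=
    { carrier := {x | (x : K) ∈ r.opIdeal P}
      zero_mem' := zero_mem (r.opIdeal P)
      add_mem' := fun hx hy => (r.opIdeal P).add_mem hx hy
      smul_mem' := fun c x hx => r.mul_mem_op_of_mem_op_one (hring.mp c.2) hx }
  have hcoe : ∀ {x : K}, x ∈ IsLocalization.coeSubmodule K I ↔ x ∈ r.opIdeal P := by
    intro x
    refine ⟨?_, fun hx => ⟨⟨x, hring.mpr (r.opIdeal_le_op_one P hx)⟩, hx, rfl⟩⟩
    rintro ⟨y, hy, rfl⟩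
    exact hy
  have hone : ∀ {x : K}, x ∈ (1 : Submodule s.ring K) ↔ x ∈ r.op 1 := by
    intro x
    rw [← hring, Submodule.mem_one]
    exact ⟨fun ⟨y, hy⟩ => hy ▸ y.2, fun hx => ⟨⟨x, hx⟩, rfl⟩⟩
  refine ⟨I, ?_, ?_, le_antisymm ?_ ?_⟩
  · ext x
    exact ⟨fun ⟨y, hy, hyx⟩ => hyx ▸ hy,
      fun hx => ⟨⟨x, hring.mpr (r.opIdeal_le_op_one P hx)⟩, hx, rfl⟩⟩
  · obtain ⟨p, hp, hp0⟩ := P.ne_bot_iff.mp hPspec.2.1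
    intro hI
    have hpI : algebraMap D s.ring p ∈ I := r.algebraMap_mem_opIdeal hp
    rw [hI, Ideal.mem_bot] at hpI
    exact hp0 (FaithfulSMul.algebraMap_injective D K
      ((congrArg Subtype.val hpI).trans (map_zero _).symm))
  · intro y hy
    rw [Submodule.mem_div_iff_forall_mul_mem] at hy
    -- `1` belongs to the dual of `P^{⋆_f}`, so the double dual lies inside `D^⋆`.
    have hy1 : y ∈ r.op 1 := by
      have := hy 1 (Submodule.mem_div_iff_forall_mul_mem.mpr fun w hw => by
        rw [one_mul]
        exact hone.mpr (r.opIdeal_le_op_one P (hcoe.mp hw)))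
      rw [mul_one] at this
      exact hone.mp this
    by_contra hyI
    obtain ⟨z, hz, hzy⟩ := hP.exists_mul_notMem hPspec (hsharp P hPspec) hPmax hy1
      fun h => hyI (hcoe.mpr h)
    refine hzy ?_
    rw [mul_comm]
    exact hone.mp (hy z (Submodule.mem_div_iff_forall_mul_mem.mpr fun w hw =>
      hone.mpr (r.opIdeal_le_op_one P (hz w (hcoe.mp hw)))))
  · intro x hx
    rw [Submodule.mem_div_iff_forall_mul_mem]
    intro z hz
    rw [mul_comm]
    exact Submodule.mem_div_iff_forall_mul_mem.mp hz x hx
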